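/- Let $K$ be an uncountable separable compact line, that is, a linearly ordered set with uncountably many points which, equipped with its order topology, is compact and separable (has a countable dense subset). Let $M$ be a nonempty compact metrizable space. Write $C(K)$ and $C(M)$ for the Banach spaces of real-valued continuous functions on $K$ and $M$ with the supremum norm. Then the Banach spaces $C(K)$ and $C(K)\oplus C(M)$ are isomorphic: there is a linear homeomorphism from $C(K)$ onto $C(K)\oplus C(M)$. -/

import Mathlib

open Filter Set Function Topology

/-! Put `N = ℕ∞ × M`. Shifting `ℕ∞` gives `N ⊕ M ≃ₜ N`, so `C(N)` absorbs `C(M)`. Hence `C(K)` does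
too once `C(N)` is complemented in it, i.e. once there are bounded `S : C(N) → C(K)` and `T : C(K) →
C(N)` with `T ∘ S = id` (`exists_leftInverse_continuousMap_line`).

Both operators average over random binary sequences with independent digits. `exists_cantor_section`
places points `e b` in `K`, with functions `v k` reading off the digits; `exists_decoding` gives a
continuous `r` from Cantor space to `N`. `S g x` is the mean of `g ∘ r` with digit probabilities `v
k x`; at `e b` the digits are certain, so `S g (e b) = g (r b)`. `T f t` is the mean of `f ∘ e` over
sequences that `r` decodes to `t`, whence `T (S g) t = g t`.

The map `e` need not be continuous. But at each level `f ∘ e` oscillates by more than `ε` on at most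
a fixed number of cylinders, and fair even digits make the mass of cylinders tend uniformly to zero,
so `T f` is still a uniform limit. -/

/-- Two binary sequences agree on their first `n` digits. -/
def AgreeUpTo (n : ℕ) (b b' : ℕ → Bool) : Prop := ∀ i < n, b i = b' i

/-- The expectation of `φ` at the random binary sequence whose first `n` digits are independent,
the `k`-th one being `true` with probability `q k`, and whose other digits are `false`. -/
noncomputable def binAvg (q : ℕ → ℝ) : ℕ → ((ℕ → Bool) → ℝ) → ℝ
  | 0, φ => φ fun _ => false
  | n + 1, φ => binAvg q n fun b =>
      q n * φ (update b n true) + (1 - q n) * φ (update b n false)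

/-- The sequences that carry the distribution in `binAvg q n`. -/
def BinSupp (q : ℕ → ℝ) (n : ℕ) (b : ℕ → Bool) : Prop :=
  (∀ k < n, (b k = true → 0 < q k) ∧ (b k = false → q k < 1)) ∧ ∀ k, n ≤ k → b k = false

/-! ### Averages over finitely many random digits -/

section binAvg

variable {q : ℕ → ℝ}

theorem binAvg_add (n : ℕ) (φ ψ : (ℕ → Bool) → ℝ) :
    binAvg q n (φ + ψ) = binAvg q n φ + binAvg q n ψ := by
  induction n generalizing φ ψ with
  | zero => rfl
  | succ n ih =>
    simp only [binAvg]
    rw [← ih]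
    congr 1
    ext b
    simp only [Pi.add_apply]
    ring

theorem binAvg_smul (n : ℕ) (c : ℝ) (φ : (ℕ → Bool) → ℝ) :
    binAvg q n (c • φ) = c * binAvg q n φ := by
  induction n generalizing φ with
  | zero => rfl
  | succ n ih =>
    simp only [binAvg]
    rw [← ih]
    congr 1
    ext b
    simp only [Pi.smul_apply, smul_eq_mul]
    ring

theorem binAvg_sub (n : ℕ) (φ ψ : (ℕ → Bool) → ℝ) :
    binAvg q n (φ - ψ) = binAvg q n φ - binAvg q n ψ := by
  have h := binAvg_add (q := q) n (φ - ψ) ψ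
  rw [sub_add_cancel] at h
  linarith

theorem binAvg_sum {ι : Type*} (s : Finset ι) (n : ℕ) (φ : ι → (ℕ → Bool) → ℝ) :
    binAvg q n (∑ i ∈ s, φ i) = ∑ i ∈ s, binAvg q n (φ i) := by
  classical
  induction s using Finset.induction_on with
  | empty =>
    have := binAvg_smul (q := q) n 0 0
    simpa using this
  | insert i s hi ih => rw [Finset.sum_insert hi, Finset.sum_insert hi, binAvg_add, ih]

theorem binAvg_const (n : ℕ) (c : ℝ) : binAvg q n (fun _ => c) = c := by
  induction n with
  | zero => rfl
  | succ n ih =>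
    simp only [binAvg]
    rw [← ih]
    congr 1
    ext b
    rw [ih]
    ring

theorem binAvg_mono_of_supp (hq : ∀ k, q k ∈ Icc (0 : ℝ) 1) (n : ℕ) {φ ψ : (ℕ → Bool) → ℝ}
    (h : ∀ b, BinSupp q n b → φ b ≤ ψ b) : binAvg q n φ ≤ binAvg q n ψ := by
  induction n generalizing φ ψ with
  | zero => exact h _ ⟨by simp, by simp⟩
  | succ n ih =>
    refine ih fun b hb => ?_
    have key : ∀ v : Bool, (v = true → 0 < q n) → (v = false → q n < 1) →
        φ (update b n v) ≤ ψ (update b n v) := by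
      intro v h1 h2
      refine h _ ⟨fun k hk => ?_, fun k hk => ?_⟩
      · rcases eq_or_ne k n with rfl | hkn
        · simpa using ⟨h1, h2⟩
        · simpa [update_of_ne hkn] using hb.1 k (by omega)
      · rw [update_of_ne (by omega)]
        exact hb.2 k (by omega)
    have h0 := (hq n).1
    have h1 := (hq n).2
    refine add_le_add ?_ ?_
    · rcases h0.eq_or_lt with h | h
      · simp [← h]
      · exact mul_le_mul_of_nonneg_left (key true (fun _ => h) (by simp)) h0
    · rcases h1.eq_or_lt with h | h
      · simp [h]
      · exact mul_le_mul_of_nonneg_left (key false (by simp) fun _ => h) (by linarith)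

theorem binAvg_mono (hq : ∀ k, q k ∈ Icc (0 : ℝ) 1) (n : ℕ) {φ ψ : (ℕ → Bool) → ℝ}
    (h : ∀ b, φ b ≤ ψ b) : binAvg q n φ ≤ binAvg q n ψ :=
  binAvg_mono_of_supp hq n fun b _ => h b

theorem abs_binAvg_sub_le_of_supp (hq : ∀ k, q k ∈ Icc (0 : ℝ) 1) (n : ℕ)
    {φ : (ℕ → Bool) → ℝ} {c ε : ℝ} (h : ∀ b, BinSupp q n b → |φ b - c| ≤ ε) :
    |binAvg q n φ - c| ≤ ε := by
  have h1 := binAvg_mono_of_supp hq n (φ := φ) (ψ := fun _ => c + ε)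
    fun b hb => by linarith [(abs_le.1 (h b hb)).2]
  have h2 := binAvg_mono_of_supp hq n (φ := fun _ => c - ε) (ψ := φ)
    fun b hb => by linarith [(abs_le.1 (h b hb)).1]
  rw [binAvg_const] at h1 h2
  exact abs_le.2 ⟨by linarith, by linarith⟩

theorem abs_binAvg_le (hq : ∀ k, q k ∈ Icc (0 : ℝ) 1) (n : ℕ) {φ ψ : (ℕ → Bool) → ℝ}
    (h : ∀ b, |φ b| ≤ ψ b) : |binAvg q n φ| ≤ binAvg q n ψ := by
  have h1 := binAvg_mono hq n fun b => (abs_le.1 (h b)).2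
  have h2 := binAvg_mono hq n (φ := (-1 : ℝ) • ψ) (ψ := φ)
    fun b => by simpa using (abs_le.1 (h b)).1
  rw [binAvg_smul] at h2
  exact abs_le.2 ⟨by linarith, h1⟩

theorem binAvg_eq_of_le {n m : ℕ} (hnm : n ≤ m) {φ : (ℕ → Bool) → ℝ}
    (hφ : ∀ b b', AgreeUpTo n b b' → φ b = φ b') : binAvg q m φ = binAvg q n φ := by
  induction m, hnm using Nat.le_induction with
  | base => rfl
  | succ m hnm ih =>
    rw [← ih, binAvg]
    congr 1
    ext b
    have (v : Bool) : φ (update b m v) = φ b :=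
      hφ _ _ fun i hi => update_of_ne (by omega) _ _
    rw [this, this]
    ring

/-- Continuity of `φ` is not needed: `ψ` may be large on a few cylinders, provided its average is
small. -/
theorem abs_binAvg_sub_binAvg_le (hq : ∀ k, q k ∈ Icc (0 : ℝ) 1) {n m : ℕ} (hnm : n ≤ m)
    {φ ψ : (ℕ → Bool) → ℝ} (hφ : ∀ b b', AgreeUpTo n b b' → |φ b - φ b'| ≤ ψ b)
    (hψ : ∀ b b', AgreeUpTo n b b' → ψ b = ψ b') :
    |binAvg q m φ - binAvg q n φ| ≤ binAvg q n ψ := by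
  -- Truncation fixes the sequences carrying `binAvg q n`, and `φ ∘ tr` depends on the first `n`
  -- digits only.
  let tr : (ℕ → Bool) → ℕ → Bool := fun b i => if i < n then b i else false
  have htr (b) : AgreeUpTo n b (tr b) := fun i hi => by simp [tr, hi]
  have h1 : binAvg q n φ = binAvg q n (φ ∘ tr) := by
    have (b) (hb : BinSupp q n b) : φ b = (φ ∘ tr) b := by
      have : tr b = b := by
        ext i
        by_cases hi : i < n
        · simp [tr, hi]
        · simp [tr, hi, hb.2 i (by omega)]
      rw [comp_apply, this]
    exact le_antisymm (binAvg_mono_of_supp hq n fun b hb => (this b hb).le)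
      (binAvg_mono_of_supp hq n fun b hb => (this b hb).ge)
  have h2 : binAvg q m (φ ∘ tr) = binAvg q n (φ ∘ tr) := by
    refine binAvg_eq_of_le hnm fun b b' h => ?_
    have : tr b = tr b' := by
      ext i
      by_cases hi : i < n
      · simp [tr, hi, h i hi]
      · simp [tr, hi]
    simp [this]
  rw [h1, ← h2, ← binAvg_sub, ← binAvg_eq_of_le hnm hψ]
  exact abs_binAvg_le hq m fun b => hφ _ _ (htr b)

-- Each fair even digit contributes a factor `1 / 2`, each odd digit at most `1`.
open Classical in
theorem binAvg_cylinder_le (hq : ∀ k, q k ∈ Icc (0 : ℝ) 1) (hq2 : ∀ k, q (2 * k) = 1 / 2)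
    (n : ℕ) (s : ℕ → Bool) :
    binAvg q (2 * n) (fun b => if AgreeUpTo (2 * n) b s then 1 else 0) ≤ (1 / 2) ^ n := by
  have step (m : ℕ) : binAvg q (m + 1) (fun b => if AgreeUpTo (m + 1) b s then 1 else 0) =
      (if s m = true then q m else 1 - q m) *
        binAvg q m (fun b => if AgreeUpTo m b s then 1 else 0) := by
    rw [binAvg, ← binAvg_smul]
    congr 1
    ext b
    have (v : Bool) : AgreeUpTo (m + 1) (update b m v) s ↔ AgreeUpTo m b s ∧ v = s m := by
      constructor
      · refine fun h => ⟨fun i hi => ?_, by simpa using h m (by omega)⟩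
        simpa [update_of_ne hi.ne] using h i (by omega)
      · rintro ⟨h, rfl⟩ i hi
        rcases eq_or_ne i m with rfl | him
        · simp
        · rw [update_of_ne him]
          exact h i (by omega)
    simp only [this, Pi.smul_apply, smul_eq_mul]
    by_cases h : AgreeUpTo m b s <;> cases s m <;> simp [h]
  induction n with
  | zero => simp [binAvg, AgreeUpTo]
  | succ n ih =>
    rw [show 2 * (n + 1) = 2 * n + 1 + 1 by ring, step, step, hq2]
    have h0 : 0 ≤ binAvg q (2 * n) (fun b => if AgreeUpTo (2 * n) b s then 1 else 0) := by
      have := binAvg_mono hq (2 * n) (φ := fun _ => 0)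
        (ψ := fun b => if AgreeUpTo (2 * n) b s then 1 else 0) fun b => by
          split_ifs
          exacts [zero_le_one, le_rfl]
      rwa [binAvg_const] at this
    have h1 : (if s (2 * n) = true then (1 / 2 : ℝ) else 1 - 1 / 2) = 1 / 2 := by
      split_ifs <;> norm_num
    have h2 : (if s (2 * n + 1) = true then q (2 * n + 1) else 1 - q (2 * n + 1)) ≤ 1 := by
      have := hq (2 * n + 1)
      split_ifs
      · exact this.2
      · linarith [this.1]
    rw [h1, pow_succ']
    calc _ ≤ 1 * (1 / 2 * binAvg q (2 * n) fun b => if AgreeUpTo (2 * n) b s then 1 else 0) :=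
          mul_le_mul_of_nonneg_right h2 (by positivity)
      _ ≤ _ := by linarith

end binAvg

/-! ### Limits of the averages -/

theorem continuous_binAvg {Y : Type*} [TopologicalSpace Y] {q : Y → ℕ → ℝ}
    (hq : ∀ k, Continuous fun y => q y k) (n : ℕ) {φ : Y → (ℕ → Bool) → ℝ}
    (hφ : ∀ b, Continuous fun y => φ y b) : Continuous fun y => binAvg (q y) n (φ y) := by
  induction n generalizing φ with
  | zero => exact hφ _
  | succ n ih =>
    have := hq n
    exact ih fun b => by have := hφ (update b n true); have := hφ (update b n false); fun_prop

theorem exists_agreeUpTo_abs_sub_le {φ : (ℕ → Bool) → ℝ} (hφ : Continuous φ) {ε : ℝ}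
    (hε : 0 < ε) : ∃ n, ∀ b b', AgreeUpTo n b b' → |φ b - φ b'| ≤ ε := by
  let _ : MetricSpace (ℕ → Bool) := PiNat.metricSpace
  have hu := @CompactSpace.uniformContinuous_of_continuous _ _
    (PiNat.metricSpace (E := fun _ => Bool)).toUniformSpace _ _ φ hφ
  obtain ⟨δ, hδ, h⟩ := (@Metric.uniformContinuous_iff _ _
    (PiNat.metricSpace (E := fun _ => Bool)).toPseudoMetricSpace _ φ).1 hu ε hε
  obtain ⟨n, hn⟩ := exists_pow_lt_of_lt_one hδ (by norm_num : (1 / 2 : ℝ) < 1)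
  refine ⟨n, fun b b' hb => (h ?_).le⟩
  have : b ∈ PiNat.cylinder b' n := fun i hi => hb i hi
  exact (PiNat.mem_cylinder_iff_dist_le.1 this).trans_lt hn

/-- Averages that are uniformly Cauchy define a bounded operator in the limit. -/
theorem exists_limit_operator {E Y : Type*} [NormedAddCommGroup E] [NormedSpace ℝ E]
    [TopologicalSpace Y] [CompactSpace Y] {q : Y → ℕ → ℝ} (hqc : ∀ k, Continuous fun y => q y k)
    (hq : ∀ y k, q y k ∈ Icc (0 : ℝ) 1) (Φ : E →ₗ[ℝ] ((ℕ → Bool) → ℝ))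
    (hΦ : ∀ g b, |Φ g b| ≤ ‖g‖)
    (hosc : ∀ g, ∀ ε > 0, ∃ n, ∃ ψ : (ℕ → Bool) → ℝ,
      (∀ b b', AgreeUpTo n b b' → |Φ g b - Φ g b'| ≤ ψ b) ∧
      (∀ b b', AgreeUpTo n b b' → ψ b = ψ b') ∧ ∀ y, binAvg (q y) n ψ ≤ ε) :
    ∃ L : E →L[ℝ] C(Y, ℝ),
      ∀ g y, Tendsto (fun n => binAvg (q y) n (Φ g)) atTop (𝓝 (L g y)) := by
  let T (n : ℕ) : E →ₗ[ℝ] C(Y, ℝ) :=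
    { toFun g := ⟨fun y => binAvg (q y) n (Φ g), continuous_binAvg hqc n fun _ => by fun_prop⟩
      map_add' g g' := by
        ext y
        simp only [map_add, ContinuousMap.coe_mk, ContinuousMap.add_apply]
        exact binAvg_add _ _ _
      map_smul' c g := by
        ext y
        simp only [map_smul, ContinuousMap.coe_mk, ContinuousMap.smul_apply, RingHom.id_apply]
        exact binAvg_smul _ _ _ }
  have hT (n g) : ‖T n g‖ ≤ ‖g‖ := by
    refine (ContinuousMap.norm_le _ (norm_nonneg g)).2 fun y => ?_
    have := abs_binAvg_le (hq y) n (hΦ g)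
    rwa [binAvg_const] at this
  have hc (g) : CauchySeq fun n => T n g := by
    refine Metric.cauchySeq_iff'.2 fun ε hε => ?_
    obtain ⟨n, ψ, h1, h2, h3⟩ := hosc g (ε / 2) (half_pos hε)
    refine ⟨n, fun m hm => lt_of_le_of_lt ?_ (half_lt_self hε)⟩
    refine (ContinuousMap.dist_le (half_pos hε).le).2 fun y => ?_
    exact (abs_binAvg_sub_binAvg_le (hq y) hm h1 h2).trans (h3 y)
  choose L hL using fun g => cauchySeq_tendsto_of_complete (hc g)
  refine ⟨(linearMapOfTendsto L T (tendsto_pi_nhds.2 hL)).mkContinuous 1 fun g => ?_,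
    fun g y => ?_⟩
  · rw [one_mul]
    exact le_of_tendsto (hL g).norm (Eventually.of_forall fun n => hT n g)
  · exact ((continuous_eval_const (F := C(Y, ℝ)) y).tendsto _).comp (hL g)

/-- The all-`false` tail of a sequence in the support may be atypical, so `φ` is only evaluated
after replacing the tail; uniform continuity absorbs the change. -/
theorem tendsto_binAvg {q : ℕ → ℝ} (hq : ∀ k, q k ∈ Icc (0 : ℝ) 1) {φ : (ℕ → Bool) → ℝ}
    (hφ : Continuous φ) {c : ℝ}
    (h : ∀ n b, BinSupp q n b → ∃ b', AgreeUpTo n b b' ∧ φ b' = c) :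
    Tendsto (fun n => binAvg q n φ) atTop (𝓝 c) := by
  refine Metric.tendsto_atTop.2 fun ε hε => ?_
  obtain ⟨n, hn⟩ := exists_agreeUpTo_abs_sub_le hφ (half_pos hε)
  refine ⟨n, fun m hm => lt_of_le_of_lt ?_ (half_lt_self hε)⟩
  refine abs_binAvg_sub_le_of_supp hq m fun b hb => ?_
  obtain ⟨b', hb', rfl⟩ := h m b hb
  exact hn _ _ fun i hi => hb' i (hi.trans_le hm)

/-! ### Cantor schemes in a separable compact line -/

section Line

variable {K : Type*} [LinearOrder K] [TopologicalSpace K] [OrderTopology K]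

/-- The initial segments ending at points of `D ∩ X`, with `D` countable dense, cover `X` up to two
points: for `x < y < z` in `X`, some `d ∈ D` lies between `x` and `z`, so it is in `X` and its
segment contains `x`. -/
theorem countable_of_countable_inter_Iic [TopologicalSpace.SeparableSpace K] {S X : Set K} (hS : S.OrdConnected)
    (hXS : X ⊆ S) (hX : ∀ x, x ∈ X ↔ x ∈ S ∧ (S ∩ Iic x).Countable) : X.Countable := by
  obtain ⟨D, hD, hd⟩ := TopologicalSpace.exists_countable_dense K
  have h1 : (⋃ d ∈ D ∩ X, S ∩ Iic d).Countable :=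
    (hD.mono inter_subset_left).biUnion fun d hd => ((hX d).1 hd.2).2
  have h2 : (X \ ⋃ d ∈ D ∩ X, S ∩ Iic d).Finite := by
    by_contra hinf
    obtain ⟨t, ht, hc⟩ :=
      (show (X \ ⋃ d ∈ D ∩ X, S ∩ Iic d).Infinite from hinf).exists_subset_card_eq 3
    obtain ⟨x, y, z, hxy, hyz, rfl⟩ : ∃ x y z : K, x < y ∧ y < z ∧ t = {x, y, z} := by
      let f := t.orderEmbOfFin hc
      refine ⟨f 0, f 1, f 2, f.strictMono (by decide), f.strictMono (by decide), ?_⟩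
      have h (a) : a ∈ t ↔ ∃ i, f i = a := by
        rw [← Finset.mem_coe, ← t.range_orderEmbOfFin hc]
        rfl
      ext a
      simp [h, Fin.exists_fin_succ, eq_comm]
    have hx := ht (show x ∈ _ by simp)
    have hz := ht (show z ∈ _ by simp)
    obtain ⟨d, ⟨hxd, hdz⟩, hdD⟩ := hd.inter_open_nonempty _ isOpen_Ioo ⟨y, hxy, hyz⟩
    have hdS : d ∈ S := hS.out (hXS hx.1) (hXS hz.1) ⟨hxd.le, hdz.le⟩
    have hdX : d ∈ X := (hX d).2 ⟨hdS, (((hX z).1 hz.1).2).mono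
      (inter_subset_inter_right _ (Iic_subset_Iic.2 hdz.le))⟩
    exact hx.2 (mem_biUnion ⟨hdD, hdX⟩ ⟨hXS hx.1, hxd.le⟩)
  exact (h1.union h2.countable).mono fun x hx => by
    by_cases h : x ∈ ⋃ d ∈ D ∩ X, S ∩ Iic d
    · exact Or.inl h
    · exact Or.inr ⟨hx, h⟩

theorem exists_lt_not_countable_inter [TopologicalSpace.SeparableSpace K] {S : Set K} (hS : S.OrdConnected)
    (hu : ¬ S.Countable) :
    ∃ x y, x < y ∧ ¬ (S ∩ Iic x).Countable ∧ ¬ (S ∩ Ici y).Countable := by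
  have h1 : {x | x ∈ S ∧ (S ∩ Iic x).Countable}.Countable :=
    countable_of_countable_inter_Iic hS (fun x hx => hx.1) fun x => Iff.rfl
  have h2 : {x | x ∈ S ∧ (S ∩ Ici x).Countable}.Countable :=
    countable_of_countable_inter_Iic (K := Kᵒᵈ) (S := S) hS.dual (fun x hx => hx.1) fun x => Iff.rfl
  have h3 : (S \ ({x | x ∈ S ∧ (S ∩ Iic x).Countable} ∪
      {x | x ∈ S ∧ (S ∩ Ici x).Countable})).Infinite := fun h =>
    hu ((h.countable.union (h1.union h2)).mono fun x hx => by
      by_contra hn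
      simp only [mem_union, Set.mem_sdiff, mem_ofPred_eq, not_or, hx, true_and] at hn
      tauto)
  obtain ⟨x, hx, y, hy, hxy⟩ := h3.nontrivial.exists_lt
  simp only [Set.mem_sdiff, mem_union, mem_ofPred_eq, not_or, not_and] at hx hy
  exact ⟨x, y, hxy, hx.2.1 hx.1, hy.2.2 hy.1⟩

/-- In a compact line, a continuous function oscillates little on all order-convex sets
that miss a suitable finite set. -/
theorem exists_finite_oscillation [CompactSpace K] (f : C(K, ℝ)) {ε : ℝ} (hε : 0 < ε) :
    ∃ P : Finset K, ∀ J : Set K, J.OrdConnected → (∀ p ∈ P, p ∉ J) →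
      ∀ x ∈ J, ∀ y ∈ J, |f x - f y| ≤ ε := by
  classical
  have h (z : K) : ∃ a c, Icc a c ∈ 𝓝 z ∧ ∀ x ∈ Icc a c, |f x - f z| ≤ ε / 2 := by
    obtain ⟨a, c, -, h1, h2⟩ := exists_Icc_mem_subset_of_mem_nhds
      (f.continuous.continuousAt (x := z) (Metric.closedBall_mem_nhds (f z) (half_pos hε)))
    exact ⟨a, c, h1, fun x hx => h2 hx⟩
  choose a c hn hac using h
  obtain ⟨t, ht⟩ := CompactSpace.elim_nhds_subcover (fun z => Icc (a z) (c z)) hn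
  -- A convex set that meets `Icc (a z) (c z)` and misses both endpoints lies inside it.
  refine ⟨t.image a ∪ t.image c, fun J hJ hP x hx y hy => ?_⟩
  obtain ⟨z, hz, hxz⟩ := mem_iUnion₂.1 (ht.ge (mem_univ x))
  have ha : a z ∉ J := hP _ (Finset.mem_union_left _ (Finset.mem_image_of_mem a hz))
  have hc : c z ∉ J := hP _ (Finset.mem_union_right _ (Finset.mem_image_of_mem c hz))
  have hyz : y ∈ Icc (a z) (c z) := by
    constructor
    · by_contra! h
      exact ha (hJ.out hy hx ⟨h.le, hxz.1⟩)
    · by_contra! h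
      exact hc (hJ.out hx hy ⟨hxz.2, h.le⟩)
  have h1 := abs_le.1 (hac z x hxz)
  have h2 := abs_le.1 (hac z y hyz)
  exact abs_le.2 ⟨by linarith, by linarith⟩

/-- A Cantor scheme of order-convex sets in an uncountable separable compact line. -/
theorem exists_cantor_scheme [TopologicalSpace.SeparableSpace K] [CompactSpace K] [Uncountable K] :
    ∃ J : ℕ → (ℕ → Bool) → Set K,
      (∀ n b, IsClosed (J n b) ∧ (J n b).OrdConnected ∧ (J n b).Nonempty ∧
        J (n + 1) b ⊆ J n b) ∧
      (∀ n b b', AgreeUpTo n b b' → J n b = J n b') ∧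
      (∀ n b b', ¬ AgreeUpTo n b b' → Disjoint (J n b) (J n b')) ∧
      ∀ n, (range (J n)).Finite := by
  -- Uncountability, unlike nonemptiness, passes to both halves of a suitable split.
  let G := {S : Set K // IsClosed S ∧ S.OrdConnected ∧ ¬ S.Countable}
  have split (S : G) : ∃ c : Bool → G,
      (∀ v, (c v).1 ⊆ S.1) ∧ Disjoint (c true).1 (c false).1 := by
    obtain ⟨S, h1, h2, h3⟩ := S
    obtain ⟨x, y, hxy, hx, hy⟩ := exists_lt_not_countable_inter h2 h3
    refine ⟨fun v => if v then ⟨S ∩ Iic x, h1.inter isClosed_Iic, h2.inter ordConnected_Iic, hx⟩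
      else ⟨S ∩ Ici y, h1.inter isClosed_Ici, h2.inter ordConnected_Ici, hy⟩, ?_, ?_⟩
    · rintro (_ | _) <;> simp
    · refine disjoint_left.2 fun z hz hz' => ?_
      simp only [if_true, Bool.false_eq_true, if_false] at hz hz'
      exact absurd (hz'.2.trans hz.2) (not_le.2 hxy)
  choose c hc hd using split
  let J : ℕ → (ℕ → Bool) → G := fun n b => Nat.rec
    ⟨univ, isClosed_univ, ordConnected_univ, not_countable_univ⟩ (fun k S => c S (b k)) n
  have hJ (n b) : J (n + 1) b = c (J n b) (b n) := rfl
  have hag (n b b') (h : AgreeUpTo n b b') : J n b = J n b' := by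
    induction n with
    | zero => rfl
    | succ n ih => rw [hJ, hJ, ih fun i hi => h i (by omega), h n (by omega)]
  refine ⟨fun n b => (J n b).1, fun n b => ⟨(J n b).2.1, (J n b).2.2.1, ?_, hc _ _⟩,
    fun n b b' h => congrArg _ (hag n b b' h), ?_, ?_⟩
  · refine nonempty_iff_ne_empty.2 fun h : (J n b).1 = ∅ => (J n b).2.2.2 ?_
    rw [h]
    exact countable_empty
  · intro n b b' h
    induction n with
    | zero => exact absurd (fun i hi => absurd hi (by omega)) h
    | succ n ih =>
      by_cases hn : AgreeUpTo n b b'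
      · have hne : b n ≠ b' n := fun he => h fun i hi => by
          rcases Nat.lt_succ_iff_lt_or_eq.1 hi with hi | rfl
          · exact hn i hi
          · exact he
        dsimp only
        rw [hJ, hJ, ← hag n b b' hn]
        cases hb : b n <;> cases hb' : b' n
        · exact absurd (hb.trans hb'.symm) hne
        · exact (hd _).symm
        · exact hd _
        · exact absurd (hb.trans hb'.symm) hne
      · exact (ih hn).mono (hc _ _) (hc _ _)
  · intro n
    suffices (range (J n)).Finite from (this.image Subtype.val).subset (by
      rintro _ ⟨b, rfl⟩
      exact ⟨_, ⟨b, rfl⟩, rfl⟩)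
    induction n with
    | zero => exact (finite_singleton (J 0 fun _ => false)).subset (by rintro _ ⟨b, rfl⟩; rfl)
    | succ n ih =>
      refine (ih.image2 c (finite_univ (α := Bool))).subset ?_
      rintro _ ⟨b, rfl⟩
      exact ⟨_, ⟨b, rfl⟩, _, mem_univ _, rfl⟩

end Line

/-- Points `e b` of the line indexed by binary sequences `b`, with continuous functions that read
off the digits, along which continuous functions oscillate on few cylinders only. -/
theorem exists_cantor_section (K : Type*) [LinearOrder K] [TopologicalSpace K] [OrderTopology K]
    [TopologicalSpace.SeparableSpace K] [CompactSpace K] [Uncountable K] :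
    ∃ (e : (ℕ → Bool) → K) (v : ℕ → C(K, ℝ)),
      (∀ k x, v k x ∈ Icc (0 : ℝ) 1) ∧ (∀ k b, v k (e b) = if b k = true then 1 else 0) ∧
      ∀ f : C(K, ℝ), ∀ ε > 0, ∃ N : ℕ, ∀ n, ∃ s : Fin N → ℕ → Bool,
        ∀ b b', AgreeUpTo n b b' → (∀ i, ¬ AgreeUpTo n b (s i)) → |f (e b) - f (e b')| ≤ ε := by
  classical
  obtain ⟨J, hJ, hag, hdis, hfin⟩ := exists_cantor_scheme (K := K)
  have he (b) : (⋂ n, J n b).Nonempty :=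
    IsCompact.nonempty_iInter_of_sequence_nonempty_isCompact_isClosed _ (fun n => (hJ n b).2.2.2)
      (fun n => (hJ n b).2.2.1) (hJ 0 b).1.isCompact fun n => (hJ n b).1
  choose e he using he
  replace he (n b) : e b ∈ J n b := mem_iInter.1 (he b) n
  have hcl (k : ℕ) (w : Bool) : IsClosed (⋃ S ∈ J (k + 1) '' {b | b k = w}, S) := by
    refine ((hfin (k + 1)).subset (image_subset_range _ _)).isClosed_biUnion ?_
    rintro _ ⟨b, -, rfl⟩
    exact (hJ _ b).1
  have hd (k : ℕ) : Disjoint (⋃ S ∈ J (k + 1) '' {b | b k = false}, S)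
      (⋃ S ∈ J (k + 1) '' {b | b k = true}, S) := by
    simp only [disjoint_iUnion_left, disjoint_iUnion_right]
    rintro _ ⟨b, hb, rfl⟩ _ ⟨b', hb', rfl⟩
    refine hdis _ _ _ fun h => ?_
    have := h k (by omega)
    simp_all
  choose v hv0 hv1 hv using fun k => exists_continuous_zero_one_of_isClosed
    (hcl k false) (hcl k true) (hd k)
  refine ⟨e, v, hv, fun k b => ?_, fun f ε hε => ?_⟩
  · cases hb : b k
    · exact hv0 k (mem_biUnion ⟨b, hb, rfl⟩ (he _ _))
    · exact hv1 k (mem_biUnion ⟨b, hb, rfl⟩ (he _ _))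
  · obtain ⟨P, hP⟩ := exists_finite_oscillation f hε
    -- The sets of one level are disjoint, so each `p ∈ P` spoils at most one cylinder, whatever `n`
    -- is.
    refine ⟨P.card, fun n => ?_⟩
    have (p : K) : ∃ s, ∀ b, p ∈ J n b → AgreeUpTo n b s := by
      by_cases h : ∃ s, p ∈ J n s
      · obtain ⟨s, hs⟩ := h
        refine ⟨s, fun b hb => ?_⟩
        by_contra hn
        exact disjoint_left.1 (hdis n b s hn) hb hs
      · exact ⟨fun _ => false, fun b hb => absurd ⟨b, hb⟩ h⟩
    choose s hs using this
    refine ⟨fun i => s (P.equivFin.symm i), fun b b' hbb' hb => ?_⟩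
    refine hP (J n b) (hJ n b).2.1 (fun p hp hpJ => ?_) _ (he n b) _ (hag n b b' hbb' ▸ he n b')
    have := hb (P.equivFin ⟨p, hp⟩)
    simp only [Equiv.symm_apply_apply] at this
    exact this (hs p b hpJ)

/-- A digit is compatible with a value: values below `0` only admit `false`,
values above `1` only admit `true`. -/
def DigitCompat (v : Bool) (x : ℝ) : Prop := (v = true → 0 ≤ x) ∧ (v = false → x ≤ 1)

theorem isClosed_digitCompat {X : Type*} [TopologicalSpace X] {v : X → Bool} {h : X → ℝ}
    (hv : Continuous v) (hh : Continuous h) : IsClosed {x | DigitCompat (v x) (h x)} := by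
  have hw (w : Bool) : IsOpen {x | v x = w} := (isOpen_discrete {w}).preimage hv
  exact (isClosed_imp (hw true) (isClosed_le continuous_const hh)).inter
    (isClosed_imp (hw false) (isClosed_le hh continuous_const))

/-! ### Coding a compact metrizable space by digits -/

section Metrizable

variable {N : Type*} [TopologicalSpace N] [CompactSpace N]

theorem exists_separating_sequence [T2Space N] [SecondCountableTopology N] :
    ∃ h : ℕ → C(N, ℝ), (∀ k t, h (2 * k) t = 1 / 2) ∧
      ∀ t t', t ≠ t' → ∃ k, h k t < 0 ∧ 1 < h k t' := by
  refine ⟨fun k => if Even k then ContinuousMap.const N (1 / 2)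
    else TopologicalSpace.denseSeq C(N, ℝ) (k / 2), fun k t => by simp, fun t t' htt' => ?_⟩
  obtain ⟨f, hf0, hf1, -⟩ := exists_continuous_zero_one_of_isClosed (isClosed_singleton (x := t))
    (isClosed_singleton (x := t')) (by simpa using htt')
  -- `g` is `-1` at `t` and `2` at `t'`, so an approximation within `1` still separates strictly.
  let g : C(N, ℝ) := (3 : ℝ) • f - ContinuousMap.const N 1
  obtain ⟨k, hk⟩ := (TopologicalSpace.denseRange_denseSeq C(N, ℝ)).exists_dist_lt g one_pos
  have hd (x : N) := abs_lt.1 ((ContinuousMap.dist_apply_le_dist x).trans_lt hk)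
  have h0 : f t = 0 := hf0 rfl
  have h1 : f t' = 1 := hf1 rfl
  have hodd : ¬ Even (2 * k + 1) := by simp
  have hdiv : (2 * k + 1) / 2 = k := by omega
  refine ⟨2 * k + 1, ?_⟩
  simp only [hodd, if_false, hdiv]
  have h2 := (hd t).1
  have h3 := (hd t').2
  simp only [g, ContinuousMap.sub_apply, ContinuousMap.smul_apply, ContinuousMap.const_apply, h0,
    h1, smul_eq_mul] at h2 h3
  constructor <;> linarith

/-- A continuous decoding of binary sequences that sends every sequence compatible with a point
to that point. -/
theorem exists_decoding [Nonempty N] (h : ℕ → C(N, ℝ))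
    (hsep : ∀ t t', t ≠ t' → ∃ k, h k t < 0 ∧ 1 < h k t') :
    ∃ r : C(ℕ → Bool, N), ∀ b t, (∀ k, DigitCompat (b k) (h k t)) → r b = t := by
  classical
  have huniq (b : ℕ → Bool) (t t' : N) (ht : ∀ k, DigitCompat (b k) (h k t))
      (ht' : ∀ k, DigitCompat (b k) (h k t')) : t = t' := by
    by_contra hne
    obtain ⟨k, h1, h2⟩ := hsep t t' hne
    cases hb : b k
    · exact absurd ((ht' k).2 hb) (not_le.2 h2)
    · exact absurd ((ht k).1 hb) (not_le.2 h1)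
  have hcl : IsClosed {p : (ℕ → Bool) × N | ∀ k, DigitCompat (p.1 k) (h k p.2)} := by
    rw [ofPred_forall]
    exact isClosed_iInter fun k => isClosed_digitCompat
      ((continuous_apply k).comp continuous_fst) ((h k).continuous.comp continuous_snd)
  let B : Set (ℕ → Bool) := Prod.fst '' {p : (ℕ → Bool) × N | ∀ k, DigitCompat (p.1 k) (h k p.2)}
  have hB : IsClosed B := isClosedMap_fst_of_compactSpace _ hcl
  have hBne : B.Nonempty := by
    obtain ⟨t⟩ := ‹Nonempty N›
    refine ⟨_, ⟨fun k => decide (0 ≤ h k t), t⟩, fun k => ⟨fun h0 => by simpa using h0,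
      fun h0 => ?_⟩, rfl⟩
    have : h k t < 0 := by simpa using h0
    linarith
  -- The closed set `B` of sequences compatible with some point is a retract of Cantor space, so it
  -- suffices to decode on `B`.
  obtain ⟨ρ, hρ, hrange, hρc⟩ := PiNat.exists_retraction_of_isClosed hB hBne
  have hex (b : ℕ → Bool) : ∃ t, ∀ k, DigitCompat (ρ b k) (h k t) := by
    obtain ⟨⟨b', t⟩, ht, h2⟩ := hrange.le (mem_range_self b)
    exact ⟨t, by rw [← h2]; exact ht⟩
  choose r hr using hex
  have hrc : Continuous r := by
    refine continuous_iff_isClosed.2 fun C hC => ?_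
    have : r ⁻¹' C = Prod.fst ''
        ({p : (ℕ → Bool) × N | ∀ k, DigitCompat (ρ p.1 k) (h k p.2)} ∩ Prod.snd ⁻¹' C) := by
      ext b
      constructor
      · exact fun hb => ⟨(b, r b), ⟨hr b, hb⟩, rfl⟩
      · rintro ⟨⟨b, t⟩, ⟨h1, h2⟩, rfl⟩
        rw [mem_preimage, huniq _ _ _ (hr b) h1]
        exact h2
    rw [this]
    refine isClosedMap_fst_of_compactSpace _ (IsClosed.inter ?_ (hC.preimage continuous_snd))
    exact hcl.preimage ((hρc.comp continuous_fst).prodMk continuous_snd)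
  refine ⟨⟨r, hrc⟩, fun b t ht => ?_⟩
  refine huniq _ _ _ (hr b) ?_
  rwa [hρ b ⟨(b, t), ht, rfl⟩]

end Metrizable

/-- The Banach space of continuous functions on a compact metrizable space is a complemented
subspace of the one on an uncountable separable compact line. -/
theorem exists_leftInverse_continuousMap_line
    (K : Type*) [LinearOrder K] [TopologicalSpace K] [OrderTopology K]
    [CompactSpace K] [TopologicalSpace.SeparableSpace K] [Uncountable K]
    (N : Type*) [TopologicalSpace N] [CompactSpace N] [T2Space N] [SecondCountableTopology N]
    [Nonempty N] :
    ∃ (S : C(N, ℝ) →L[ℝ] C(K, ℝ)) (T : C(K, ℝ) →L[ℝ] C(N, ℝ)), LeftInverse T S := by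
  classical
  obtain ⟨e, v, hv, hve, hosc⟩ := exists_cantor_section K
  obtain ⟨h, hh, hsep⟩ := exists_separating_sequence (N := N)
  obtain ⟨r, hr⟩ := exists_decoding h hsep
  obtain ⟨S, hS⟩ : ∃ S : C(N, ℝ) →L[ℝ] C(K, ℝ), ∀ (g : C(N, ℝ)) x,
      Tendsto (fun n => binAvg (fun k => v k x) n (g ∘ r)) atTop (𝓝 (S g x)) := by
    refine exists_limit_operator (fun k => (v k).continuous) (fun x k => hv k x)
      { toFun (g : C(N, ℝ)) := g ∘ r, map_add' _ _ := rfl, map_smul' _ _ := rfl }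
      (fun g b => g.norm_coe_le_norm (r b)) fun g ε hε => ?_
    obtain ⟨n, hn⟩ := exists_agreeUpTo_abs_sub_le (g.continuous.comp r.continuous) hε
    exact ⟨n, fun _ => ε, hn, fun _ _ _ => rfl, fun x => (binAvg_const n ε).le⟩
  -- Clamping gives probability zero to every digit incompatible with `h k t`.
  let q (t : N) (k : ℕ) : ℝ := max 0 (min 1 (h k t))
  have hqc (k : ℕ) : Continuous fun t => q t k :=
    continuous_const.max (continuous_const.min (h k).continuous)
  have hq (t k) : q t k ∈ Icc (0 : ℝ) 1 := ⟨le_max_left _ _, max_le zero_le_one (min_le_left _ _)⟩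
  have hq2 (t k) : q t (2 * k) = 1 / 2 := by
    simp only [q, hh]
    norm_num
  obtain ⟨T, hT⟩ : ∃ T : C(K, ℝ) →L[ℝ] C(N, ℝ), ∀ (f : C(K, ℝ)) t,
      Tendsto (fun n => binAvg (q t) n (f ∘ e)) atTop (𝓝 (T f t)) := by
    refine exists_limit_operator hqc hq
      { toFun (f : C(K, ℝ)) := f ∘ e, map_add' _ _ := rfl, map_smul' _ _ := rfl }
      (fun f b => f.norm_coe_le_norm (e b)) fun f ε hε => ?_
    obtain ⟨m, hm⟩ := hosc f (ε / 2) (half_pos hε)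
    -- The at most `m` bad cylinders then contribute at most `2 * ‖f‖ * m * (1 / 2) ^ n ≤ ε / 2`;
    -- the `+ 1` keeps the denominator positive.
    obtain ⟨n, hn⟩ := exists_pow_lt_of_lt_one
      (show 0 < ε / (2 * (m * (2 * ‖f‖) + 1)) by positivity) (by norm_num : (1 / 2 : ℝ) < 1)
    obtain ⟨s, hs⟩ := hm (2 * n)
    let χ (i : Fin m) (b : ℕ → Bool) : ℝ := if AgreeUpTo (2 * n) b (s i) then 1 else 0
    have hχ (i b) : 0 ≤ χ i b := by
      simp only [χ]
      split_ifs <;> simp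
    refine ⟨2 * n, (fun _ => ε / 2) + (2 * ‖f‖) • ∑ i, χ i, fun b b' hbb' => ?_,
      fun b b' hbb' => ?_, fun t => ?_⟩
    · simp only [Pi.add_apply, Pi.smul_apply, Finset.sum_apply, smul_eq_mul]
      have hsum : 0 ≤ ∑ i, χ i b := Finset.sum_nonneg fun i _ => hχ i b
      by_cases hb : ∃ i, AgreeUpTo (2 * n) b (s i)
      · obtain ⟨i, hi⟩ := hb
        have h1 : 1 ≤ ∑ i, χ i b := by
          have := Finset.single_le_sum (f := fun i => χ i b) (fun j _ => hχ j b)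
            (Finset.mem_univ i)
          simpa [χ, hi] using this
        have h2 := abs_le.1 (f.norm_coe_le_norm (e b))
        have h3 := abs_le.1 (f.norm_coe_le_norm (e b'))
        have h4 : |f (e b) - f (e b')| ≤ 2 * ‖f‖ :=
          abs_le.2 ⟨by linarith, by linarith⟩
        have h5 := mul_le_mul_of_nonneg_left h1 (show 0 ≤ 2 * ‖f‖ by positivity)
        exact h4.trans (by linarith)
      · exact (hs b b' hbb' (not_exists.1 hb)).trans (by
          have : 0 ≤ 2 * ‖f‖ * ∑ i, χ i b := by positivity
          linarith)
    · have (i : Fin m) : AgreeUpTo (2 * n) b (s i) ↔ AgreeUpTo (2 * n) b' (s i) :=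
        ⟨fun h j hj => (hbb' j hj).symm.trans (h j hj), fun h j hj => (hbb' j hj).trans (h j hj)⟩
      simp [χ, this]
    · rw [binAvg_add, binAvg_smul, binAvg_sum, binAvg_const]
      have h1 : ∑ i, binAvg (q t) (2 * n) (χ i) ≤ m * (1 / 2) ^ n := by
        have := Finset.sum_le_sum fun i (_ : i ∈ Finset.univ) =>
          binAvg_cylinder_le (hq t) (hq2 t) n (s i)
        simpa using this
      have h2 := mul_le_mul_of_nonneg_left h1 (show 0 ≤ 2 * ‖f‖ by positivity)
      rw [lt_div_iff₀ (by positivity)] at hn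
      have h3 : (0 : ℝ) < (1 / 2) ^ n := by positivity
      nlinarith
  refine ⟨S, T, fun g => ?_⟩
  have hSe (b : ℕ → Bool) : S g (e b) = g (r b) := by
    refine tendsto_nhds_unique (hS g (e b))
      (tendsto_binAvg (fun k => hv k _) (g.continuous.comp r.continuous) fun n b' hb' =>
        ⟨b, fun i hi => ?_, rfl⟩)
    have := hb'.1 i hi
    simp only [hve] at this
    cases hb : b i <;> cases hb2 : b' i <;> simp_all
  ext t
  have hTt := hT (S g) t
  rw [show S g ∘ e = g ∘ r from funext hSe] at hTt
  refine tendsto_nhds_unique hTt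
    (tendsto_binAvg (hq t) (g.continuous.comp r.continuous) fun n b hb => ?_)
  -- Beyond `n` the tail is replaced by digits compatible with `t`, so that `r` decodes to `t`.
  refine ⟨fun i => if i < n then b i else decide (0 ≤ h i t), fun i hi => by simp [hi],
    congrArg g (hr _ _ fun k => ?_)⟩
  by_cases hk : k < n
  · simp only [hk, if_true]
    refine ⟨fun hb1 => ?_, fun hb0 => ?_⟩
    · have := (hb.1 k hk).1 hb1
      by_contra! hneg
      simp [q, hneg.le] at this
    · have := (hb.1 k hk).2 hb0
      by_contra! hneg
      simp [q, hneg.le] at this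
  · simp only [hk, if_false]
    refine ⟨fun h0 => by simpa using h0, fun h0 => ?_⟩
    have : h k t < 0 := by simpa using h0
    linarith

/-! ### Absorbing `C(M)` -/

/-- Adding a copy of `M` to the product of `M` with a convergent sequence changes nothing. -/
noncomputable def sumENatProdHomeomorph (M : Type*) [TopologicalSpace M] [CompactSpace M]
    [T2Space M] : (ℕ∞ × M) ⊕ M ≃ₜ ℕ∞ × M :=
  Continuous.homeoOfEquivCompactToT2
    -- The shift fixes `⊤` and vacates level `0`, which receives the extra copy of `M`.
    (f := Equiv.ofBijective (Sum.elim (fun p => (p.1 + 1, p.2)) fun x => (0, x)) (by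
      constructor
      · rintro (⟨a, x⟩ | x) (⟨b, y⟩ | y) hxy
        · simp_all
        · simp_all
        · simp_all [eq_comm (a := (0 : ℕ∞))]
        · simp_all
      · rintro ⟨a, x⟩
        rcases eq_or_ne a 0 with rfl | ha
        · exact ⟨Sum.inr x, rfl⟩
        · exact ⟨Sum.inl (a - 1, x), by
            simp [tsub_add_cancel_of_le (Order.one_le_iff_ne_zero.2 ha)]⟩))
    (by
      refine Continuous.sumElim ?_ ?_
      · exact (continuous_fst.add continuous_const).prodMk continuous_snd
      · exact continuous_const.prodMk continuous_id)

/-- Continuous functions on a disjoint union. -/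
theorem nonempty_continuousMap_sum_equiv (X Y Z : Type*) [TopologicalSpace X] [CompactSpace X]
    [TopologicalSpace Y] [CompactSpace Y] [TopologicalSpace Z] [CompactSpace Z]
    (φ : X ⊕ Y ≃ₜ Z) : Nonempty (C(Z, ℝ) ≃L[ℝ] C(X, ℝ) × C(Y, ℝ)) := by
  let i : C(X, Z) := ⟨fun x => φ (Sum.inl x), φ.continuous.comp continuous_inl⟩
  let j : C(Y, Z) := ⟨fun y => φ (Sum.inr y), φ.continuous.comp continuous_inr⟩
  let L : C(Z, ℝ) →L[ℝ] C(X, ℝ) × C(Y, ℝ) :=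
    { toFun f := (f.comp i, f.comp j)
      map_add' _ _ := rfl
      map_smul' _ _ := rfl
      cont := (ContinuousMap.continuous_precomp i).prodMk (ContinuousMap.continuous_precomp j) }
  refine ⟨ContinuousLinearEquiv.ofBijective L (LinearMap.ker_eq_bot.2 fun f g hfg => ?_)
    (LinearMap.range_eq_top.2 fun fg => ?_)⟩
  · ext z
    obtain ⟨w, rfl⟩ := φ.surjective z
    have hfg' : (f.comp i, f.comp j) = (g.comp i, g.comp j) := hfg
    rcases w with x | y
    · exact DFunLike.congr_fun (congrArg Prod.fst hfg') x
    · exact DFunLike.congr_fun (congrArg Prod.snd hfg') y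
  · refine ⟨⟨Sum.elim fg.1 fg.2 ∘ φ.symm,
      (fg.1.continuous.sumElim fg.2.continuous).comp φ.symm.continuous⟩, ?_⟩
    refine Prod.ext (ContinuousMap.ext fun x => ?_) (ContinuousMap.ext fun y => ?_)
    · simp [L, i]
    · simp [L, j]

theorem mainTheorem6
    {K : Type*} [LinearOrder K] [TopologicalSpace K] [OrderTopology K]
    [CompactSpace K] [TopologicalSpace.SeparableSpace K] [Uncountable K]
    {M : Type*} [TopologicalSpace M] [CompactSpace M] [TopologicalSpace.MetrizableSpace M]
    [Nonempty M] :
    Nonempty (C(K, ℝ) ≃L[ℝ] (C(K, ℝ) × C(M, ℝ))) := by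
  let _ : MetricSpace M := TopologicalSpace.metrizableSpaceMetric M
  obtain ⟨S, T, hTS⟩ := exists_leftInverse_continuousMap_line K (ℕ∞ × M)
  obtain ⟨A⟩ := nonempty_continuousMap_sum_equiv _ _ _ (sumENatProdHomeomorph M)
  -- `D` splits `C(K)` as `C(N) × ker T`; then `C(M)` is pulled out of the first factor and `C(K)`
  -- is reassembled.
  let D := ContinuousLinearEquiv.equivOfRightInverse T S hTS
  let A' := A.trans (.prodComm ℝ _ _)
  exact ⟨D.trans <| (A'.prodCongr (.refl ℝ _)).trans <|
    (ContinuousLinearEquiv.prodAssoc ℝ _ _ _).trans <|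
    ((ContinuousLinearEquiv.refl ℝ _).prodCongr D.symm).trans (.prodComm ℝ _ _)⟩
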